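/- Let $(R,\mathfrak m)$ be a Cohen-Macaulay (Noetherian) local ring with $\dim R=1$. Let $\mathrm v(R)=\mu_R(\mathfrak m)$ be its embedding dimension, i.e. the number of elements in a minimal system of generators of $\mathfrak m$, and let $\mathrm e(R)=\lim_{n\to\infty}\ell_R(R/\mathfrak m^n)/n$ be its multiplicity, where $\ell_R$ denotes length. An $\mathfrak m$-primary ideal $I$ of $R$ is called an Ulrich ideal if it contains a parameter ideal $Q$ of $R$ (an $\mathfrak m$-primary ideal generated by $\dim R=1$ element) as a reduction (i.e. $I^{n+1}=QI^n$ for some $n\ge 0$) such that $I\neq Q$ and $I^2=QI$, and if $I/I^2$ is a free $R/I$-module. Suppose that $R$ has minimal multiplicity in the sense that $\mathrm v(R)=\mathrm e(R)>1$. Then the set of all Ulrich ideals of $R$ is totally ordered by inclusion: for any two Ulrich ideals $I,J$ of $R$, either $I\subseteq J$ or $J\subseteq I$. -/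

import Mathlib

/-- A Noetherian local ring is Cohen-Macaulay if `depth R = dim R`, i.e. if there is an `R`-regular
sequence (which then automatically lies in the maximal ideal) of length `dim R`. -/
def IsCohenMacaulayLocal (R : Type*) [CommRing R] [IsLocalRing R] : Prop :=
  IsNoetherianRing R ∧ ∃ rs : List R,
    RingTheory.Sequence.IsRegular R rs ∧ ringKrullDim R = (rs.length : WithBot ℕ∞)

/-- `I` is `𝔪`-primary. -/
def Ideal.IsMPrimary {R : Type*} [CommRing R] [IsLocalRing R] (I : Ideal R) : Prop :=
  I.radical = IsLocalRing.maximalIdeal R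

/-- A parameter ideal: an `𝔪`-primary ideal generated by `dim R` elements. -/
def Ideal.IsParameterIdeal {R : Type*} [CommRing R] [IsLocalRing R] (Q : Ideal R) : Prop :=
  Q.IsMPrimary ∧ ∃ (d : ℕ) (a : Fin d → R),
    ringKrullDim R = (d : WithBot ℕ∞) ∧ Q = Ideal.span (Set.range a)

/-- `Q` is a reduction of `I`. -/
def Ideal.IsReductionOf {R : Type*} [CommRing R] (Q I : Ideal R) : Prop :=
  Q ≤ I ∧ ∃ n : ℕ, I ^ (n + 1) = Q * I ^ n

/-- `I` is an Ulrich ideal: it is `𝔪`-primary, contains a parameter ideal `Q` as a reduction,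
`I ≠ Q`, `I ^ 2 = Q I`, and `I / I ^ 2` (in Mathlib: `I.Cotangent`) is a free `R / I`-module. -/
def Ideal.IsUlrich {R : Type*} [CommRing R] [IsLocalRing R] (I : Ideal R) : Prop :=
  I.IsMPrimary ∧
    (∃ Q : Ideal R, Q.IsParameterIdeal ∧ Q.IsReductionOf I ∧ I ≠ Q ∧ I ^ 2 = Q * I) ∧
    Module.Free (R ⧸ I) I.Cotangent

/-- The set of all Ulrich ideals of `R`. -/
def ulrichIdeals (R : Type*) [CommRing R] [IsLocalRing R] : Set (Ideal R) :=
  {I | I.IsUlrich}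

/-- The embedding dimension: the number of elements in a minimal system of generators
of the maximal ideal. -/
noncomputable def embeddingDim (R : Type*) [CommRing R] [IsLocalRing R] : ℕ :=
  (IsLocalRing.maximalIdeal R).spanFinrank

/-- In a one-dimensional Noetherian local ring, `e` is the multiplicity of `R` with respect to the
`𝔪`-primary ideal `𝔞`: `e = lim ℓ(R / 𝔞 ^ n) / n`. All these lengths are finite there. -/
def Ideal.HasMultiplicity {R : Type*} [CommRing R] (𝔞 : Ideal R) (e : ℝ) : Prop :=
  Filter.Tendsto (fun n : ℕ => ((Module.length R (R ⧸ 𝔞 ^ n)).toNat : ℝ) / (n : ℝ))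
    Filter.atTop (nhds e)

/-! Suppose first that `𝔪 ^ 2 = x 𝔪` with `x` regular. An Ulrich ideal `I` then satisfies `𝔪 I = x
I` and `𝔪 = (x) + I`. While `x ^ j ∉ I` for all `j ≤ k`, the ideal `I + (x ^ (k + 1))` consists of
the `y` in `L = I + (x ^ k)` with `y ^ 2 ∈ x ^ (k + 1) L`. Hence these ideals start at the whole
ring and do not depend on `I`. If `p` is the least exponent for which `x ^ p` lies in one of `I`,
`J`, say in `I`, then `J ⊆ J + (x ^ p) = I + (x ^ p) = I` (`UlrichData.le_or_le`).

Finding `x` in `R` by general position would need a large residue field, so it is found in a finite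
free local extension `S = R[X]/(g)` with maximal ideal `𝔪 S` (`exists_monic_sq_eq`). Let `F` be a
polynomial whose coefficients generate `𝔪`. Multiplication by `F` is injective on polynomials over
the associated graded ring in large degrees, so the number of generators `μ(𝔪 ^ n)` is eventually
nondecreasing. Its averages tend to `e = v`, hence it is eventually `v`. The matrix of `F` from `𝔪 ^
N` to `𝔪 ^ (N + 1)` is then square with determinant `P` nonzero modulo `𝔪`. Choosing `g` so that `P`
becomes a unit gives `𝔪 ^ (N + 1) S = f 𝔪 ^ N S`, where `f` is the class of `F`, and a length count
turns this into `𝔪 ^ 2 S = f 𝔪 S`.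

Ulrich ideals extend to `S` (`UlrichData.map_algebraMap`), and inclusions descend by faithful
flatness. -/

theorem Ideal.mul_mem_sq {S : Type*} [CommRing S] {I : Ideal S} {z w : S} (hz : z ∈ I)
    (hw : w ∈ I) : z * w ∈ I ^ 2 := by
  rw [sq]; exact Ideal.mul_mem_mul hz hw

/-! ### Ulrich ideals in a local ring with `𝔪 ^ 2 = x 𝔪`. -/

open IsLocalRing in
/-- Data on an ideal `I` of a local ring that encode the Ulrich property in dimension one:
`I ^ 2 = a I` for a regular element `a ∈ I`, and a finite family generating `I` whose classes form
a basis of `I / I ^ 2` over the quotient by `I`, with at least two members. -/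
structure UlrichData {S : Type*} [CommRing S] [IsLocalRing S] (I : Ideal S) (a : S)
    {ι : Type*} [Fintype ι] (u : ι → S) : Prop where
  le_max : I ≤ maximalIdeal S
  regular : IsLeftRegular a
  mem : a ∈ I
  sq_le : ∀ z ∈ I ^ 2, ∃ w ∈ I, z = a * w
  span_eq : Ideal.span (Set.range u) = I
  indep : ∀ r : ι → S, ∑ i, r i * u i ∈ I ^ 2 → ∀ i, r i ∈ I
  nontrivial : Nontrivial ι

namespace UlrichData

open IsLocalRing

variable {S : Type*} [CommRing S] [IsLocalRing S] {I : Ideal S} {a : S}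
  {ι : Type*} [Fintype ι] {u : ι → S}

theorem u_mem (h : UlrichData I a u) (i : ι) : u i ∈ I := by
  rw [← h.span_eq]; exact Ideal.subset_span ⟨i, rfl⟩

theorem exists_coeff (h : UlrichData I a u) {z : S} (hz : z ∈ I) :
    ∃ r : ι → S, z = ∑ i, r i * u i := by
  rw [← h.span_eq, Ideal.mem_span_range_iff_exists_fun] at hz
  obtain ⟨c, hc⟩ := hz
  exact ⟨c, hc.symm⟩

theorem ite_sub_mem_of_mul_sub_sum_mem [DecidableEq ι] (h : UlrichData I a u)
    {i : ι} {b : S} {r : ι → S}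
    (hb : b * u i - ∑ j, r j * u j ∈ I ^ 2) (j : ι) :
    (if j = i then b else 0) - r j ∈ I :=
  h.indep (fun j => (if j = i then b else 0) - r j) (by
    simpa [sub_mul, Finset.sum_sub_distrib, ite_mul] using hb) j

/-- Otherwise `I ^ 2 = a I ⊆ 𝔪 I ^ 2`, so `I ^ 2 = 0` by Nakayama and `a ^ 2 = 0`, against
regularity of `a`. -/
theorem notMem_max_mul [IsNoetherianRing S] (h : UlrichData I a u) : a ∉ maximalIdeal S * I := by
  intro ha
  have h1 : I ^ 2 ≤ maximalIdeal S • I ^ 2 := by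
    intro z hz
    obtain ⟨w, hw, rfl⟩ := h.sq_le z hz
    rw [smul_eq_mul, sq, ← mul_assoc]
    exact Ideal.mul_mem_mul ha hw
  have h2 : I ^ 2 = ⊥ := Submodule.eq_bot_of_le_smul_of_le_jacobson_bot _ _
    (IsNoetherian.noetherian _) h1 (by rw [IsLocalRing.jacobson_eq_maximalIdeal _ bot_ne_top])
  have h3 : a * a ∈ I ^ 2 := Ideal.mul_mem_sq h.mem h.mem
  rw [h2, Submodule.mem_bot] at h3
  have h4 : a = 0 := h.regular (by simpa using h3)
  exact one_ne_zero (h.regular (show a * 1 = a * 0 by simp [h4]))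

/-- `(a) : I ≤ I`. -/
theorem mem_of_forall_dvd [IsNoetherianRing S] (h : UlrichData I a u) {c : S}
    (hc : ∀ z ∈ I, a ∣ c * z) : c ∈ I := by
  classical
  obtain ⟨α, hα⟩ := h.exists_coeff h.mem
  obtain ⟨i, hi⟩ : ∃ i, IsUnit (α i) := by
    by_contra! hcon
    apply h.notMem_max_mul
    rw [hα]
    exact Ideal.sum_mem _ fun i _ => Ideal.mul_mem_mul
      ((IsLocalRing.mem_maximalIdeal _).2 (hcon i)) (h.u_mem i)
  have := h.nontrivial
  obtain ⟨j, hj⟩ := exists_ne i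
  obtain ⟨s, hs⟩ := hc _ (h.u_mem j)
  -- The relation `c u_j = s a = ∑ s α_l u_l` is compared coefficientwise modulo `I`. Index `i`,
  -- where `α i` is a unit, gives `s ∈ I`; index `j` then gives `c ∈ I`.
  have key := h.ite_sub_mem_of_mul_sub_sum_mem (i := j) (b := c) (r := fun l => s * α l) (by
    have : c * u j - ∑ l, s * α l * u l = 0 := by
      rw [hs]; nth_rw 1 [hα]
      rw [mul_comm, Finset.mul_sum]
      simp [mul_assoc]
    rw [this]; exact zero_mem _)
  have hsI : s ∈ I := by
    have := key i
    rw [if_neg hj.symm, zero_sub, neg_mem_iff, mul_comm] at this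
    exact (Ideal.unit_mul_mem_iff_mem _ hi).1 this
  have := key j
  rw [if_pos rfl] at this
  simpa using add_mem this (I.mul_mem_right (α j) hsI)

variable {x : S}

/-- If `𝔪 ^ 2 = x 𝔪`, then `𝔪 I = x I`. -/
theorem exists_mul_eq [IsNoetherianRing S] (h : UlrichData I a u) (hx : IsLeftRegular x)
    (hm : ∀ y ∈ maximalIdeal S, ∀ z ∈ maximalIdeal S, ∃ w ∈ maximalIdeal S, y * z = x * w)
    {b z : S} (hb : b ∈ maximalIdeal S) (hz : z ∈ I) : ∃ w ∈ I, b * z = x * w := by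
  -- Here `c = ab / x`. It multiplies `𝔪` into `(a)`, hence lies in `(a) : I ≤ I`, so that `c z ∈ I
  -- ^ 2 = a I`; cancelling `a` returns to `b z`.
  obtain ⟨c, hc, hac⟩ := hm a (h.le_max h.mem) b hb
  have hcm : ∀ y ∈ maximalIdeal S, a ∣ c * y := by
    intro y hy
    obtain ⟨w, hw, hyw⟩ := hm b hb y hy
    refine ⟨w, hx ?_⟩
    linear_combination a * hyw - y * hac
  have hcI : c ∈ I := h.mem_of_forall_dvd fun y hy => hcm y (h.le_max hy)
  obtain ⟨w, hw, hcw⟩ := h.sq_le _ (Ideal.mul_mem_sq hcI hz)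
  refine ⟨w, hw, h.regular ?_⟩
  linear_combination z * hac + x * hcw

/-- If `𝔪 ^ 2 = x 𝔪`, then `𝔪 = (x) + I`. -/
theorem exists_sub_mem [IsNoetherianRing S] (h : UlrichData I a u) (hx : IsLeftRegular x)
    (hm : ∀ y ∈ maximalIdeal S, ∀ z ∈ maximalIdeal S, ∃ w ∈ maximalIdeal S, y * z = x * w)
    {b : S} (hb : b ∈ maximalIdeal S) : ∃ r, b - x * r ∈ I := by
  classical
  have := h.nontrivial
  obtain ⟨i⟩ : Nonempty ι := inferInstance
  obtain ⟨w, hw, hbw⟩ := h.exists_mul_eq hx hm hb (h.u_mem i)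
  obtain ⟨r, hr⟩ := h.exists_coeff hw
  have key := h.ite_sub_mem_of_mul_sub_sum_mem (i := i) (b := b) (r := fun l => x * r l) (by
    rw [hbw, hr, Finset.mul_sum]
    simp [mul_assoc]) i
  rw [if_pos rfl] at key
  exact ⟨_, key⟩

/-- If `𝔪 ^ 2 = x 𝔪` and `x ^ j ∉ I` for `j < k`, then `I ^ 2 ⊆ x ^ k I`. -/
theorem exists_pow_mul_eq [IsNoetherianRing S] (h : UlrichData I a u) (hx : IsLeftRegular x)
    (hm : ∀ y ∈ maximalIdeal S, ∀ z ∈ maximalIdeal S, ∃ w ∈ maximalIdeal S, y * z = x * w)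
    (k : ℕ) (hk : ∀ j < k, x ^ j ∉ I) {z : S} (hz : z ∈ I ^ 2) : ∃ w ∈ I, z = x ^ k * w := by
  induction k with
  | zero => exact ⟨z, Ideal.pow_le_self two_ne_zero hz, by simp⟩
  | succ k ih =>
    obtain ⟨w, hw, rfl⟩ := ih fun j hj => hk j (by omega)
    obtain ⟨r, hr⟩ := h.exists_coeff hw
    have hrm : ∀ i, r i ∈ maximalIdeal S := by
      intro i
      by_contra hi
      have hu : IsUnit (r i) := by simpa using hi
      -- Freeness of `I / I ^ 2` forces `x ^ k r_i ∈ I`, so a unit `r_i` would put `x ^ k` in `I`.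
      -- Thus `w ∈ 𝔪 I = x I`.
      have := h.indep (fun i => x ^ k * r i) (by
        rw [hr, Finset.mul_sum] at hz
        simpa [mul_assoc] using hz) i
      exact hk k (by omega) ((Ideal.mul_unit_mem_iff_mem _ hu).1 this)
    choose v hv hrv using fun i => h.exists_mul_eq hx hm (hrm i) (h.u_mem i)
    refine ⟨∑ i, v i, sum_mem fun i _ => hv i, ?_⟩
    rw [hr, Finset.sum_congr rfl fun i _ => hrv i, ← Finset.mul_sum]
    ring

/-- The ideals `I + (x ^ k)` obey a recursion that does not involve `I`. -/
theorem mem_sup_span_pow_succ_iff [IsNoetherianRing S] (h : UlrichData I a u)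
    (hx : IsLeftRegular x)
    (hm : ∀ y ∈ maximalIdeal S, ∀ z ∈ maximalIdeal S, ∃ w ∈ maximalIdeal S, y * z = x * w)
    (hxm : x ∈ maximalIdeal S) (k : ℕ) (hk : ∀ j ≤ k, x ^ j ∉ I) (y : S) :
    y ∈ I ⊔ Ideal.span {x ^ (k + 1)} ↔ y ∈ I ⊔ Ideal.span {x ^ k} ∧
      ∃ w ∈ I ⊔ Ideal.span {x ^ k}, y * y = x ^ (k + 1) * w := by
  simp only [Submodule.mem_sup, Ideal.mem_span_singleton']
  constructor
  · rintro ⟨i, hi, _, ⟨s, rfl⟩, rfl⟩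
    refine ⟨⟨i, hi, _, ⟨s * x, rfl⟩, by ring⟩, ?_⟩
    obtain ⟨w, hw, hiw⟩ := h.exists_pow_mul_eq hx hm (k + 1) (fun j hj => hk j (by omega))
      (Ideal.mul_mem_sq hi hi)
    refine ⟨_, ⟨w + i * (2 * s), add_mem hw (I.mul_mem_right _ hi), _, ⟨s ^ 2 * x, rfl⟩, rfl⟩, ?_⟩
    linear_combination hiw
  · rintro ⟨⟨i, hi, _, ⟨r, rfl⟩, rfl⟩, _, ⟨i', hi', _, ⟨t, rfl⟩, rfl⟩, hw⟩
    by_cases hr : IsUnit r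
    · exfalso
      obtain ⟨w, hw', hiw⟩ := h.exists_pow_mul_eq hx hm k (fun j hj => hk j (by omega))
        (Ideal.mul_mem_sq hi hi)
      have hu : IsUnit (r ^ 2 - x * t) := by
        by_contra hcon
        have h1 : r ^ 2 - x * t ∈ maximalIdeal S := hcon
        have h2 := add_mem h1 (Ideal.mul_mem_right t _ hxm)
        rw [sub_add_cancel] at h2
        exact h2 (hr.pow 2)
      -- With `y = i + r x ^ k` and `i ^ 2 = x ^ k w`, this is the equation for `y ^ 2` divided by
      -- `x ^ k`. As `r ^ 2 - x t` is a unit, it would give `x ^ k ∈ I`.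
      have h3 : x ^ k * (r ^ 2 - x * t) = x * i' - w - 2 * r * i := by
        apply hx.pow k
        linear_combination hw - hiw
      have h4 : x ^ k * (r ^ 2 - x * t) ∈ I := by
        rw [h3]
        exact sub_mem (sub_mem (I.mul_mem_left _ hi') hw') (I.mul_mem_left _ hi)
      exact hk k le_rfl ((Ideal.mul_unit_mem_iff_mem _ hu).1 h4)
    · obtain ⟨s, hs⟩ := h.exists_sub_mem hx hm (b := r) hr
      exact ⟨i + x ^ k * (r - x * s), add_mem hi (I.mul_mem_left _ hs), _, ⟨s, rfl⟩, by ring⟩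

variable {J : Ideal S} {b : S} {κ : Type*} [Fintype κ] {v : κ → S}

/-- Both sides are the whole ring for `k = 0` and obey the same recursion. -/
theorem sup_span_pow_eq [IsNoetherianRing S] (hI : UlrichData I a u) (hJ : UlrichData J b v)
    (hx : IsLeftRegular x)
    (hm : ∀ y ∈ maximalIdeal S, ∀ z ∈ maximalIdeal S, ∃ w ∈ maximalIdeal S, y * z = x * w)
    (hxm : x ∈ maximalIdeal S) (k : ℕ) (hkI : ∀ j < k, x ^ j ∉ I) (hkJ : ∀ j < k, x ^ j ∉ J) :
    I ⊔ Ideal.span {x ^ k} = J ⊔ Ideal.span {x ^ k} := by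
  induction k with
  | zero => simp
  | succ k ih =>
    have ih := ih (fun j hj => hkI j (by omega)) (fun j hj => hkJ j (by omega))
    ext y
    rw [hI.mem_sup_span_pow_succ_iff hx hm hxm k (fun j hj => hkI j (by omega)),
      hJ.mem_sup_span_pow_succ_iff hx hm hxm k (fun j hj => hkJ j (by omega)), ih]

/-- If `𝔪 ^ 2 = x 𝔪`, then ideals with Ulrich data are comparable. -/
theorem le_or_le [IsNoetherianRing S] (hI : UlrichData I a u) (hJ : UlrichData J b v)
    (hx : IsLeftRegular x)
    (hm : ∀ y ∈ maximalIdeal S, ∀ z ∈ maximalIdeal S, ∃ w ∈ maximalIdeal S, y * z = x * w)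
    (hxm : x ∈ maximalIdeal S) (hxI : ∃ p, x ^ p ∈ I) (hxJ : ∃ p, x ^ p ∈ J) : I ≤ J ∨ J ≤ I := by
  classical
  have aux : ∀ {I J : Ideal S} {k : ℕ}, I ⊔ Ideal.span {x ^ k} = J ⊔ Ideal.span {x ^ k} →
      x ^ k ∈ J → I ≤ J := by
    intro I J k h hk
    rw [sup_eq_left.2 ((Ideal.span_singleton_le_iff_mem J).2 hk)] at h
    exact h ▸ le_sup_left
  rcases le_total (Nat.find hxI) (Nat.find hxJ) with h | h
  · right
    exact aux (hJ.sup_span_pow_eq hI hx hm hxm _ (fun j hj => Nat.find_min hxJ (hj.trans_le h))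
      (fun j hj => Nat.find_min hxI hj)) (Nat.find_spec hxI)
  · left
    exact aux (hI.sup_span_pow_eq hJ hx hm hxm _ (fun j hj => Nat.find_min hxI (hj.trans_le h))
      (fun j hj => Nat.find_min hxJ hj)) (Nat.find_spec hxJ)

end UlrichData

open Polynomial IsLocalRing

/-! ### Torsion in the associated graded ring. -/

namespace Ideal

variable {R : Type*} [CommRing R] (I : Ideal R)

/-- For `Z ≤ I ^ n`, the condition `I ^ j * Z ≤ I ^ (n + j + 1)` says that degree `j` of the
associated graded ring kills the image of `Z` in degree `n`. Inequalities of this shape are read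
this way below. -/
theorem pow_add_mul_le {n j i : ℕ} {Z : Ideal R} (h : I ^ j * Z ≤ I ^ (n + j + 1)) :
    I ^ (j + i) * Z ≤ I ^ (n + (j + i) + 1) := by
  calc I ^ (j + i) * Z = I ^ i * (I ^ j * Z) := by rw [pow_add]; ring
    _ ≤ I ^ i * I ^ (n + j + 1) := Ideal.mul_mono_right h
    _ = I ^ (n + (j + i) + 1) := by rw [← pow_add]; congr 1; omega

/-- The filtration of `R` whose `n`-th step consists of the elements of `I ^ n` whose initial forms
in the associated graded ring are annihilated by some power of the irrelevant ideal. -/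
def saturationFiltration : I.Filtration R where
  N n :=
    { carrier := {z | z ∈ I ^ n ∧ ∃ j, I ^ j * span {z} ≤ I ^ (n + j + 1)}
      zero_mem' := ⟨zero_mem _, 0, by simp⟩
      add_mem' := by
        rintro z w ⟨hz, i, hi⟩ ⟨hw, j, hj⟩
        refine ⟨add_mem hz hw, i + j, ?_⟩
        calc I ^ (i + j) * span {z + w} ≤ I ^ (i + j) * (span {z} ⊔ span {w}) := by
              refine Ideal.mul_mono_right ((span_singleton_le_iff_mem _).2 ?_)
              exact add_mem (mem_sup_left (mem_span_singleton_self z))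
                (mem_sup_right (mem_span_singleton_self w))
          _ ≤ I ^ (n + (i + j) + 1) := by
              rw [Ideal.mul_sup]
              refine sup_le (I.pow_add_mul_le hi) ?_
              rw [add_comm i j]
              exact I.pow_add_mul_le hj
      smul_mem' := by
        rintro c z ⟨hz, i, hi⟩
        refine ⟨Ideal.mul_mem_left _ c hz, i, le_trans (Ideal.mul_mono_right ?_) hi⟩
        rw [span_singleton_le_iff_mem]
        exact Ideal.mul_mem_left _ c (mem_span_singleton_self z) }
  mono n := by
    rintro z ⟨hz, -⟩
    exact ⟨Ideal.pow_le_pow_right (Nat.le_succ n) hz, 0, by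
      simpa [span_singleton_le_iff_mem] using hz⟩
  smul_le n := by
    rw [smul_eq_mul, Ideal.mul_le]
    rintro c hc z ⟨hz, j, hj⟩
    refine ⟨by rw [pow_succ']; exact Ideal.mul_mem_mul hc hz, j, ?_⟩
    calc I ^ j * span {c * z} = span {c} * (I ^ j * span {z}) := by
          rw [← span_singleton_mul_span_singleton]; ring
      _ ≤ I * I ^ (n + j + 1) := Ideal.mul_mono ((span_singleton_le_iff_mem _).2 hc) hj
      _ = I ^ (n + 1 + j + 1) := by rw [← pow_succ']; congr 1; omega

theorem mem_saturationFiltration {n : ℕ} {z : R} :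
    z ∈ I.saturationFiltration.N n ↔ z ∈ I ^ n ∧ ∃ j, I ^ j * span {z} ≤ I ^ (n + j + 1) := Iff.rfl

theorem exists_forall_pow_mul_le [IsNoetherianRing R] (n : ℕ) :
    ∃ j, I ^ j * I.saturationFiltration.N n ≤ I ^ (n + j + 1) := by
  have key : ∀ s : Finset R, (∀ z ∈ s, z ∈ I.saturationFiltration.N n) →
      ∃ j, I ^ j * span (s : Set R) ≤ I ^ (n + j + 1) := by
    classical
    intro s
    induction s using Finset.induction_on with
    | empty => intro _; exact ⟨0, by simp⟩
    | insert z s _ ih =>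
      intro h
      obtain ⟨i, hi⟩ := ih fun w hw => h w (Finset.mem_insert_of_mem hw)
      obtain ⟨-, j, hj⟩ := I.mem_saturationFiltration.1 (h z (Finset.mem_insert_self z s))
      refine ⟨i + j, ?_⟩
      rw [Finset.coe_insert, span_insert, Ideal.mul_sup]
      refine sup_le ?_ (I.pow_add_mul_le hi)
      rw [add_comm i j]
      exact I.pow_add_mul_le hj
  obtain ⟨s, hs⟩ := IsNoetherian.noetherian (I.saturationFiltration.N n)
  obtain ⟨j, hj⟩ := key s fun z hz => by rw [← hs]; exact subset_span hz
  exact ⟨j, by rw [← hs]; exact hj⟩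

/-- In large degrees, the associated graded ring of a Noetherian ring has no elements annihilated by
a power of the irrelevant ideal. -/
theorem exists_forall_mem_pow_succ [IsNoetherianRing R] :
    ∃ n₀, ∀ n ≥ n₀, ∀ z ∈ I ^ n, (∃ j, I ^ j * span {z} ≤ I ^ (n + j + 1)) → z ∈ I ^ (n + 1) := by
  -- Artin-Rees: stability gives `N (n₁ + k) = I ^ k N n₁`. One exponent `j` works for all of the
  -- finitely generated `N n₁`, so for `k ≥ j` this lies in `I ^ (n₁ + k + 1)`.
  have hst : I.saturationFiltration.Stable := by
    refine Ideal.Filtration.Stable.of_le (I.stableFiltration_stable (⊤ : Submodule R R)) ?_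
    intro n z hz
    simpa [Ideal.stableFiltration] using (I.mem_saturationFiltration.1 hz).1
  obtain ⟨n₁, h₁⟩ := hst.exists_pow_smul_eq
  obtain ⟨j, hj⟩ := I.exists_forall_pow_mul_le n₁
  refine ⟨n₁ + j, fun n hn z hz hz' => ?_⟩
  obtain ⟨k, rfl⟩ := Nat.exists_eq_add_of_le hn
  have h2 : z ∈ I.saturationFiltration.N (n₁ + (j + k)) :=
    I.mem_saturationFiltration.2 (by rw [← add_assoc]; exact ⟨hz, hz'⟩)
  rw [h₁, smul_eq_mul] at h2
  have := I.pow_add_mul_le (i := k) hj h2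
  rwa [← add_assoc] at this

/-- In each term `J ^ t K ^ (E + D - t)` of the binomial expansion, either the exponent of `J` is at
least `E` or that of `K` is at least `D`. -/
theorem sup_pow_mul_le {J K Z : Ideal R} {n E D : ℕ} (hJ : J ≤ I) (hK : K ≤ I)
    (hJZ : J ^ E * Z ≤ I ^ (n + E + 1)) (hKZ : K ^ D * Z ≤ I ^ (n + D + 1)) :
    (J ⊔ K) ^ (E + D) * Z ≤ I ^ (n + (E + D) + 1) := by
  rw [← Submodule.add_eq_sup, add_pow, Finset.sum_mul, Ideal.sum_eq_sup]
  refine Finset.sup_le fun t ht => ?_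
  have ht : t ≤ E + D := by simpa [Nat.lt_succ_iff] using ht
  refine le_trans (Ideal.mul_mono_left Ideal.mul_le_left) ?_
  rcases le_total E t with h | h
  · obtain ⟨s, rfl⟩ := Nat.exists_eq_add_of_le h
    calc J ^ (E + s) * K ^ (E + D - (E + s)) * Z
        = J ^ s * K ^ (E + D - (E + s)) * (J ^ E * Z) := by rw [pow_add]; ring
      _ ≤ I ^ s * I ^ (E + D - (E + s)) * I ^ (n + E + 1) := by gcongr
      _ = I ^ (n + (E + D) + 1) := by rw [← pow_add, ← pow_add]; congr 1; omega
  · obtain ⟨s, hs⟩ : ∃ s, E + D - t = D + s := ⟨E - t, by omega⟩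
    calc J ^ t * K ^ (E + D - t) * Z = J ^ t * K ^ s * (K ^ D * Z) := by rw [hs, pow_add]; ring
      _ ≤ I ^ t * I ^ s * I ^ (n + D + 1) := by gcongr
      _ = I ^ (n + (E + D) + 1) := by rw [← pow_add, ← pow_add]; congr 1; omega

theorem exists_span_pow_mul_le {Z : Ideal R} {n : ℕ} (s : Finset R) (hs : ∀ y ∈ s, y ∈ I)
    (h : ∀ y ∈ s, ∃ E, span {y} ^ E * Z ≤ I ^ (n + E + 1)) :
    ∃ E, span (s : Set R) ^ E * Z ≤ I ^ (n + E + 1) := by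
  classical
  induction s using Finset.induction_on with
  | empty => exact ⟨1, by simp⟩
  | insert y s _ ih =>
    obtain ⟨E, hE⟩ := ih (fun w hw => hs w (Finset.mem_insert_of_mem hw))
      (fun w hw => h w (Finset.mem_insert_of_mem hw))
    obtain ⟨D, hD⟩ := h y (Finset.mem_insert_self y s)
    refine ⟨D + E, ?_⟩
    rw [Finset.coe_insert, span_insert]
    exact I.sup_pow_mul_le ((span_singleton_le_iff_mem _).2 (hs y (Finset.mem_insert_self y s)))
      (span_le.2 fun w hw => hs w (Finset.mem_insert_of_mem hw)) hD hE

end Ideal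

/-! ### Multiplication by a generic polynomial on the associated graded ring. -/

namespace Polynomial

variable {R : Type*} [CommRing R] {I : Ideal R}

/-- Multiplying the `i`-th coefficient of `F * g` by `F.coeff 0 ^ i` makes every term except
`F.coeff 0 ^ (i + 1) * g.coeff i` fall under the induction hypothesis. -/
theorem coeff_zero_pow_mul_coeff_mem {F g : R[X]} {n : ℕ} (hF : ∀ i, F.coeff i ∈ I)
    (hFg : ∀ i, (F * g).coeff i ∈ I ^ (n + 2)) (i : ℕ) :
    F.coeff 0 ^ (i + 1) * g.coeff i ∈ I ^ (n + i + 2) := by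
  induction i using Nat.strong_induction_on with
  | _ i ih =>
    have h1 : F.coeff 0 ^ i * (F * g).coeff i ∈ I ^ (n + i + 2) := by
      have := Ideal.mul_mem_mul (Ideal.pow_mem_pow (hF 0) i) (hFg i)
      rwa [← pow_add, show i + (n + 2) = n + i + 2 by omega] at this
    rw [coeff_mul, Finset.Nat.sum_antidiagonal_eq_sum_range_succ_mk, Finset.sum_range_succ',
      mul_add] at h1
    have h2 : F.coeff 0 ^ i * ∑ k ∈ Finset.range i, F.coeff (k + 1) * g.coeff (i - (k + 1)) ∈
        I ^ (n + i + 2) := by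
      rw [Finset.mul_sum]
      refine sum_mem fun k hk => ?_
      have hk : k < i := by simpa using hk
      obtain ⟨b, rfl⟩ := Nat.exists_eq_add_of_lt hk
      have h3 := ih b (by omega)
      have h4 := Ideal.mul_mem_mul (Ideal.mul_mem_mul (hF (k + 1)) (Ideal.pow_mem_pow (hF 0) k)) h3
      rw [← pow_succ', ← pow_add, show k + 1 + (n + b + 2) = n + (k + b + 1) + 2 by omega] at h4
      convert h4 using 1
      rw [show k + b + 1 - (k + 1) = b by omega]
      ring
    have h5 := (Submodule.add_mem_iff_right _ h2).1 h1
    simpa [pow_succ, mul_assoc] using h5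

/-- If `F g = 0` over the graded ring, each coefficient of `F` has a power killing `g`. The outer
induction shortens `F` to `F.divX`; the inner one is on `D` with `F.coeff 0 ^ D` killing `g`. -/
theorem exists_coeff_pow_mul_coeff_mem (s : ℕ) : ∀ F : R[X], (∀ i, s ≤ i → F.coeff i = 0) →
    (∀ i, F.coeff i ∈ I) → ∀ (l n : ℕ) (g : R[X]), (∀ i, g.coeff i ∈ I ^ n) →
    (∀ i, (F * g).coeff i ∈ I ^ (n + 2)) →
    ∃ E, ∀ i, F.coeff l ^ E * g.coeff i ∈ I ^ (n + E + 1) := by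
  induction s with
  | zero =>
    intro F hF _ l n g _ _
    exact ⟨1, fun i => by simp [hF l (Nat.zero_le _)]⟩
  | succ s ih =>
    intro F hFs hF l n g hg hFg
    have h0 : ∀ (n : ℕ) (g : R[X]), (∀ i, (F * g).coeff i ∈ I ^ (n + 2)) →
        ∃ E, ∀ i, F.coeff 0 ^ E * g.coeff i ∈ I ^ (n + E + 1) := by
      intro n g hFg
      refine ⟨g.natDegree + 1, fun i => ?_⟩
      rcases lt_or_ge g.natDegree i with hi | hi
      · simp [coeff_eq_zero_of_natDegree_lt hi]
      · have h1 := Ideal.mul_mem_mul (Ideal.pow_mem_pow (hF 0) (g.natDegree - i))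
          (coeff_zero_pow_mul_coeff_mem hF hFg i)
        rw [← mul_assoc, ← pow_add, ← pow_add,
          show g.natDegree - i + (i + 1) = g.natDegree + 1 by omega,
          show g.natDegree - i + (n + i + 2) = n + (g.natDegree + 1) + 1 by omega] at h1
        exact h1
    cases l with
    | zero => exact h0 n g hFg
    | succ l =>
      have step : ∀ (D n : ℕ) (g : R[X]), (∀ i, g.coeff i ∈ I ^ n) →
          (∀ i, (F * g).coeff i ∈ I ^ (n + 2)) →
          (∀ i, F.coeff 0 ^ D * g.coeff i ∈ I ^ (n + D + 1)) →
          ∃ E, ∀ i, F.coeff (l + 1) ^ E * g.coeff i ∈ I ^ (n + E + 1) := by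
        intro D
        induction D with
        | zero =>
          intro n g _ _ h
          exact ⟨0, by simpa using h⟩
        | succ D ihD =>
          intro n g hg hFg hD
          have hC : ∀ (c : R) (k n : ℕ) (g : R[X]), c ∈ I ^ k → (∀ i, g.coeff i ∈ I ^ n) →
              ∀ i, (C c * g).coeff i ∈ I ^ (n + k) := by
            intro c k n g hc hg i
            rw [coeff_C_mul, add_comm n k, pow_add]
            exact Ideal.mul_mem_mul hc (hg i)
          have h1 : ∀ i, (F * (C (F.coeff 0 ^ D) * g)).coeff i ∈ I ^ (n + D + 2) := by
            intro i
            rw [mul_left_comm, show n + D + 2 = n + 2 + D by omega]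
            exact hC _ _ _ _ (Ideal.pow_mem_pow (hF 0) D) hFg i
          -- `F.coeff 0` kills `F.coeff 0 ^ D * g` over the graded ring, so `F.divX` kills it too.
          obtain ⟨E, hE⟩ := ih F.divX (fun i hi => by rw [coeff_divX]; exact hFs _ (by omega))
            (fun i => by rw [coeff_divX]; exact hF _) l (n + D) (C (F.coeff 0 ^ D) * g)
            (hC _ _ _ _ (Ideal.pow_mem_pow (hF 0) D) hg) (fun i => by
              have h2 := h1 (i + 1)
              have h3 := hD (i + 1)
              nth_rw 1 [← divX_mul_X_add F] at h2
              rw [add_mul, coeff_add, mul_right_comm, coeff_mul_X, coeff_C_mul, coeff_C_mul,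
                ← mul_assoc (F.coeff 0), ← pow_succ'] at h2
              exact (Submodule.add_mem_iff_left _ h3).1 h2)
          rw [coeff_divX] at hE
          -- After multiplication by `F.coeff (l + 1) ^ E`, the polynomial `g` is already killed by
          -- `F.coeff 0 ^ D`.
          obtain ⟨E', hE'⟩ := ihD (n + E) (C (F.coeff (l + 1) ^ E) * g)
            (hC _ _ _ _ (Ideal.pow_mem_pow (hF _) E) hg) (fun i => by
              rw [mul_left_comm, show n + E + 2 = n + 2 + E by omega]
              exact hC _ _ _ _ (Ideal.pow_mem_pow (hF _) E) hFg i)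
            (fun i => by
              have := hE i
              rw [coeff_C_mul] at this ⊢
              rw [mul_left_comm, show n + E + D + 1 = n + D + E + 1 by omega]
              exact this)
          refine ⟨E' + E, fun i => ?_⟩
          have := hE' i
          rw [coeff_C_mul, ← mul_assoc, ← pow_add] at this
          rwa [show n + (E' + E) + 1 = n + E + E' + 1 by omega]
      obtain ⟨D, hD⟩ := h0 n g hFg
      exact step D n g hg hFg hD

/-- A polynomial whose coefficients generate `I` acts injectively on the polynomials over the
associated graded ring of `I` in large degrees. -/
theorem exists_forall_coeff_mem_pow_succ [IsNoetherianRing R] (F : R[X])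
    (hF : Ideal.span (Set.range F.coeff) = I) :
    ∃ n₀, ∀ n ≥ n₀, ∀ g : R[X], (∀ i, g.coeff i ∈ I ^ n) →
      (∀ i, (F * g).coeff i ∈ I ^ (n + 2)) → ∀ i, g.coeff i ∈ I ^ (n + 1) := by
  classical
  have hFI : ∀ i, F.coeff i ∈ I := fun i => by
    rw [← hF]; exact Ideal.subset_span ⟨i, rfl⟩
  obtain ⟨n₀, h₀⟩ := I.exists_forall_mem_pow_succ
  refine ⟨n₀, fun n hn g hg hFg i => h₀ n hn _ (hg i) ?_⟩
  obtain ⟨E, hE⟩ := I.exists_span_pow_mul_le (Z := Ideal.span {g.coeff i}) (n := n)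
    ((Finset.range (F.natDegree + 1)).image F.coeff) (by simp [hFI]) (by
      simp only [Finset.mem_image]
      rintro _ ⟨l, -, rfl⟩
      obtain ⟨E, hE⟩ := exists_coeff_pow_mul_coeff_mem (F.natDegree + 1) F
        (fun i hi => coeff_eq_zero_of_natDegree_lt (by omega)) hFI l n g hg hFg
      refine ⟨E, ?_⟩
      rw [Ideal.span_singleton_pow, Ideal.span_singleton_mul_span_singleton,
        Ideal.span_singleton_le_iff_mem]
      exact hE i)
  refine ⟨E, ?_⟩
  have : I ≤ Ideal.span (((Finset.range (F.natDegree + 1)).image F.coeff : Finset R) : Set R) := by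
    rw [← hF, Ideal.span_le]
    rintro _ ⟨l, rfl⟩
    rcases lt_or_ge F.natDegree l with hl | hl
    · simp [coeff_eq_zero_of_natDegree_lt hl]
    · exact Ideal.subset_span (Finset.mem_coe.2 (Finset.mem_image_of_mem _ (by simp; omega)))
  exact le_trans (Ideal.mul_mono_left (Ideal.pow_right_mono this E)) hE

end Polynomial

/-! ### Numbers of generators of the powers of `𝔪`. -/

namespace IsLocalRing

variable {R : Type*} [CommRing R] [IsLocalRing R]

/-- Multiplication by a polynomial `F` with coefficients in `𝔪`, from `𝔪 ^ n` to `𝔪 ^ (n + 1)`,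
in terms of minimal generators. -/
theorem exists_matrix_of_mul {F : R[X]} (hF : ∀ i, F.coeff i ∈ maximalIdeal R) {n : ℕ}
    (hn : ∀ g : R[X], (∀ i, g.coeff i ∈ maximalIdeal R ^ n) →
      (∀ i, (F * g).coeff i ∈ maximalIdeal R ^ (n + 2)) →
      ∀ i, g.coeff i ∈ maximalIdeal R ^ (n + 1))
    {ι κ : Type*} [Fintype ι] [Fintype κ] {u : ι → R} {w : κ → R}
    (hu : Ideal.span (Set.range u) = maximalIdeal R ^ n)
    (hu' : ∀ r : ι → R, ∑ i, r i * u i ∈ maximalIdeal R ^ (n + 1) → ∀ i, r i ∈ maximalIdeal R)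
    (hw : Ideal.span (Set.range w) = maximalIdeal R ^ (n + 1)) :
    ∃ M : Matrix ι κ R[X], (∀ i, F * C (u i) = ∑ j, M i j * C (w j)) ∧
      Function.Injective fun c : ι → (ResidueField R)[X] =>
        Matrix.vecMul c (M.map (mapRingHom (residue R))) := by
  have huN : ∀ i, u i ∈ maximalIdeal R ^ n := fun i => by
    rw [← hu]; exact Ideal.subset_span ⟨i, rfl⟩
  have hwN : ∀ i, w i ∈ maximalIdeal R ^ (n + 1) := fun i => by
    rw [← hw]; exact Ideal.subset_span ⟨i, rfl⟩
  have h1 : ∀ i, ∃ c : κ → R[X], ∑ j, c j * C (w j) = F * C (u i) := by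
    intro i
    have h2 : F * C (u i) ∈ (maximalIdeal R ^ (n + 1)).map C := by
      rw [Ideal.mem_map_C_iff]
      intro l
      rw [coeff_mul_C, pow_succ']
      exact Ideal.mul_mem_mul (hF l) (huN i)
    rw [← hw, Ideal.map_span, ← Set.range_comp, Ideal.mem_span_range_iff_exists_fun] at h2
    exact h2
  choose M hM using h1
  refine ⟨M, fun i => (hM i).symm, ?_⟩
  have hker : ∀ c : ι → (ResidueField R)[X],
      Matrix.vecMul c (Matrix.map M (mapRingHom (residue R))) = 0 → c = 0 := by
    intro c hc
    choose d hd using fun i => Polynomial.map_surjective _ (residue_surjective (R := R)) (c i)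
    have h3 : ∀ j l, (∑ i, d i * M i j).coeff l ∈ maximalIdeal R := by
      intro j l
      have h4 : (∑ i, d i * M i j).map (residue R) = 0 := by
        simp only [Polynomial.map_sum, Polynomial.map_mul, hd]
        exact congrFun hc j
      have h5 := congrArg (fun p => p.coeff l) h4
      simp only [coeff_map, coeff_zero] at h5
      exact (residue_eq_zero_iff _).1 h5
    have h6 : F * ∑ i, d i * C (u i) = ∑ j, (∑ i, d i * M i j) * C (w j) := by
      simp_rw [Finset.mul_sum, Finset.sum_mul]
      rw [Finset.sum_comm]
      refine Finset.sum_congr rfl fun i _ => ?_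
      rw [mul_left_comm, ← hM, Finset.mul_sum]
      simp [mul_assoc]
    have h7 := hn (∑ i, d i * C (u i)) (fun l => by
      rw [finsetSum_coeff]
      exact sum_mem fun i _ => by rw [coeff_mul_C]; exact Ideal.mul_mem_left _ _ (huN i))
      (fun l => by
        rw [h6, finsetSum_coeff]
        refine sum_mem fun j _ => ?_
        rw [coeff_mul_C, show n + 2 = (n + 1) + 1 from rfl, pow_succ' _ (n + 1)]
        exact Ideal.mul_mem_mul (h3 j l) (hwN j))
    funext i
    rw [← hd, Pi.zero_apply]
    ext l
    rw [coeff_map, coeff_zero, residue_eq_zero_iff]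
    refine hu' (fun i => (d i).coeff l) ?_ i
    have := h7 l
    rw [finsetSum_coeff] at this
    simpa only [coeff_mul_C] using this
  intro c c' h
  rw [← sub_eq_zero]
  apply hker
  rw [Matrix.sub_vecMul]
  exact sub_eq_zero.2 h


variable [IsNoetherianRing R]

/-- A minimal system of generators, indexed by `Fin`. -/
theorem exists_minimal_generators (N : Ideal R) {t : ℕ} (ht : t = N.spanFinrank) :
    ∃ u : Fin t → R, Ideal.span (Set.range u) = N ∧
      ∀ r : Fin t → R, ∑ i, r i * u i ∈ maximalIdeal R * N → ∀ i, r i ∈ maximalIdeal R := by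
  classical
  have hfg : N.FG := N.fg_of_isNoetherianRing
  obtain ⟨s, hs, hspan⟩ := Submodule.FG.exists_span_finset_card_eq_spanFinrank hfg
  let e : Fin t ≃ s := (s.equivFinOfCardEq (hs.trans ht.symm)).symm
  have hrange : Set.range (fun i => (e i : R)) = s := by
    rw [show (fun i => (e i : R)) = Subtype.val ∘ e from rfl, Set.range_comp, e.range_eq_univ]
    simp
  refine ⟨fun i => e i, by rw [hrange]; exact hspan, fun r hr i => ?_⟩
  -- If `r i` were a unit, the other generators would suffice by Nakayama, contradicting minimality
  -- of `t`.
  by_contra hi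
  have hu : IsUnit (r i) := by simpa using hi
  set v : Fin t → R := fun i => e i with hv
  set T : Set R := v '' {i}ᶜ with hT
  have hvN : ∀ j, v j ∈ N := fun j => by
    rw [← hspan]; exact Submodule.subset_span (e j).2
  have hle : N ≤ Ideal.span T ⊔ maximalIdeal R • N := by
    conv_lhs => rw [← hspan, ← hrange]
    rw [Submodule.span_le]
    rintro _ ⟨j, rfl⟩
    by_cases hj : j = i
    · subst hj
      have h1 : r j * v j ∈ Ideal.span T ⊔ maximalIdeal R • N := by
        rw [← Finset.add_sum_erase _ _ (Finset.mem_univ j)] at hr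
        have h2 : ∑ l ∈ Finset.univ.erase j, r l * v l ∈ Ideal.span T := by
          refine sum_mem fun l hl => Ideal.mul_mem_left _ _ (Ideal.subset_span ⟨l, ?_, rfl⟩)
          simpa using hl
        have h3 := sub_mem (show _ ∈ Ideal.span T ⊔ maximalIdeal R • N from Ideal.mem_sup_right hr)
          (Ideal.mem_sup_left h2)
        rw [add_sub_cancel_right] at h3
        exact h3
      exact (Ideal.unit_mul_mem_iff_mem _ hu).1 h1
    · exact Ideal.mem_sup_left (Ideal.subset_span ⟨j, hj, rfl⟩)
  have hle2 : N ≤ Ideal.span T := Submodule.le_of_le_smul_of_le_jacobson_bot hfg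
    (by rw [IsLocalRing.jacobson_eq_maximalIdeal _ bot_ne_top]) hle
  have hNT : Ideal.span T = N := le_antisymm (Ideal.span_le.2 (by
    rintro _ ⟨j, -, rfl⟩; exact hvN j)) hle2
  have h1 : N.spanFinrank ≤ T.ncard := by
    conv_lhs => rw [← hNT]
    exact Submodule.spanFinrank_span_le_ncard_of_finite (Set.toFinite _)
  have h2 : T.ncard ≤ ({i}ᶜ : Set (Fin t)).ncard := Set.ncard_image_le (Set.toFinite _)
  have h3 : ({i}ᶜ : Set (Fin t)).ncard + 1 = t := by
    have := Set.ncard_add_ncard_compl ({i} : Set (Fin t))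
    rw [Set.ncard_singleton, Nat.card_eq_fintype_card, Fintype.card_fin] at this
    omega
  omega

theorem length_quotient_maximalIdeal_mul (N : Ideal R) :
    Module.length R (R ⧸ maximalIdeal R * N) = N.spanFinrank + Module.length R (R ⧸ N) := by
  have hle : maximalIdeal R * N ≤ N := Ideal.mul_le_right
  have hcomap : maximalIdeal R • (⊤ : Submodule R N) =
      Submodule.comap N.subtype (maximalIdeal R * N) := by
    rw [← Submodule.comap_map_eq_of_injective N.subtype_injective (maximalIdeal R • ⊤),
      Submodule.map_smul'', Submodule.map_top, Submodule.range_subtype, smul_eq_mul]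
  have h := Module.length_eq_add_of_exact (R := R)
    (Submodule.mapQ (maximalIdeal R • (⊤ : Submodule R N)) (maximalIdeal R * N) N.subtype hcomap.le)
    (Submodule.factor hle) (by
      rw [← LinearMap.ker_eq_bot, Submodule.ker_mapQ, ← hcomap, Submodule.mkQ_map_self])
    (Submodule.factor_surjective hle) (by
      rw [LinearMap.exact_iff, Submodule.range_mapQ, Submodule.range_subtype, Submodule.factor,
        Submodule.ker_mapQ, Submodule.comap_id])
  rw [h, IsLocalRing.spanFinrank_eq_finrank_quotient N N.fg_of_isNoetherianRing]
  congr 1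
  let _ := Ideal.Quotient.field (maximalIdeal R)
  rw [Module.length_eq_of_surjective (R := R ⧸ maximalIdeal R) (S := R)
    Ideal.Quotient.mk_surjective, Module.length_eq_finrank]

theorem length_quotient_maximalIdeal_pow_succ (n : ℕ) :
    Module.length R (R ⧸ maximalIdeal R ^ (n + 1)) =
      (maximalIdeal R ^ n).spanFinrank + Module.length R (R ⧸ maximalIdeal R ^ n) := by
  rw [pow_succ', length_quotient_maximalIdeal_mul]

theorem length_quotient_maximalIdeal_pow (n : ℕ) :
    Module.length R (R ⧸ maximalIdeal R ^ n) =
      ((∑ i ∈ Finset.range n, (maximalIdeal R ^ i).spanFinrank : ℕ) : ℕ∞) := by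
  induction n with
  | zero =>
    simp only [Finset.range_zero, Finset.sum_empty, Nat.cast_zero, Module.length_eq_zero_iff]
    rw [pow_zero, Ideal.one_eq_top]
    infer_instance
  | succ n ih =>
    rw [length_quotient_maximalIdeal_pow_succ, ih, Finset.sum_range_succ, Nat.cast_add, add_comm]

/-- The matrix of `F` modulo `𝔪` is an injection of free modules over the polynomial ring of the
residue field, so it cannot lower the rank. -/
theorem spanFinrank_pow_le_succ {F : R[X]} (hF : ∀ i, F.coeff i ∈ maximalIdeal R) {n : ℕ}
    (hn : ∀ g : R[X], (∀ i, g.coeff i ∈ maximalIdeal R ^ n) →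
      (∀ i, (F * g).coeff i ∈ maximalIdeal R ^ (n + 2)) →
      ∀ i, g.coeff i ∈ maximalIdeal R ^ (n + 1)) :
    (maximalIdeal R ^ n).spanFinrank ≤ (maximalIdeal R ^ (n + 1)).spanFinrank := by
  obtain ⟨u, hu, hu'⟩ := exists_minimal_generators (maximalIdeal R ^ n) rfl
  obtain ⟨w, hw, hw'⟩ := exists_minimal_generators (maximalIdeal R ^ (n + 1)) rfl
  rw [← pow_succ'] at hu'
  obtain ⟨M, -, hM⟩ := exists_matrix_of_mul hF hn hu hu' hw
  exact le_of_fin_injective _ (Matrix.vecMulLinear (M.map (mapRingHom (residue R)))) hM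

/-- If `𝔪 ^ n` and `𝔪 ^ (n + 1)` need equally many generators, then a generic combination `F` of
generators of `𝔪` maps `𝔪 ^ n` onto `𝔪 ^ (n + 1)` after inverting a polynomial `P`. -/
theorem exists_mul_mem_of_spanFinrank_eq {F : R[X]} (hF : ∀ i, F.coeff i ∈ maximalIdeal R) {n : ℕ}
    (hn : ∀ g : R[X], (∀ i, g.coeff i ∈ maximalIdeal R ^ n) →
      (∀ i, (F * g).coeff i ∈ maximalIdeal R ^ (n + 2)) →
      ∀ i, g.coeff i ∈ maximalIdeal R ^ (n + 1))
    (h : (maximalIdeal R ^ n).spanFinrank = (maximalIdeal R ^ (n + 1)).spanFinrank) :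
    ∃ P : R[X], P.map (residue R) ≠ 0 ∧ ∀ z ∈ maximalIdeal R ^ (n + 1),
      P * C z ∈ Ideal.span {F} * (maximalIdeal R ^ n).map C := by
  obtain ⟨u, hu, hu'⟩ := exists_minimal_generators (maximalIdeal R ^ n) rfl
  obtain ⟨w, hw, hw'⟩ := exists_minimal_generators (maximalIdeal R ^ (n + 1)) h
  rw [← pow_succ'] at hu'
  obtain ⟨M, hM, hinj⟩ := exists_matrix_of_mul hF hn hu hu' hw
  refine ⟨M.det, ?_, ?_⟩
  · intro hdet
    rw [← coe_mapRingHom, RingHom.map_det, RingHom.mapMatrix_apply] at hdet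
    obtain ⟨c, hc, hc'⟩ := Matrix.exists_vecMul_eq_zero_iff.2 hdet
    exact hc (hinj (by simpa using hc'))
  · intro z hz
    rw [← hw, Ideal.mem_span_range_iff_exists_fun] at hz
    obtain ⟨c, rfl⟩ := hz
    rw [map_sum, Finset.mul_sum]
    refine sum_mem fun j _ => ?_
    rw [C_mul, mul_left_comm]
    refine Ideal.mul_mem_left _ _ ?_
    have h1 : M.det * C (w j) = F * ∑ i, M.adjugate j i * C (u i) := by
      have h2 : ∀ l, (M.adjugate * M) j l = (M.det • (1 : Matrix _ _ R[X])) j l := fun l => by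
        rw [Matrix.adjugate_mul]
      calc M.det * C (w j) = ∑ l, (M.det • (1 : Matrix _ _ R[X])) j l * C (w l) := by
            simp [Matrix.one_apply]
        _ = ∑ l, (∑ i, M.adjugate j i * M i l) * C (w l) := by
            simp_rw [← h2, Matrix.mul_apply]
        _ = F * ∑ i, M.adjugate j i * C (u i) := by
            simp_rw [Finset.mul_sum, Finset.sum_mul]
            rw [Finset.sum_comm]
            refine Finset.sum_congr rfl fun i _ => ?_
            rw [mul_left_comm, hM, Finset.mul_sum]
            simp [mul_assoc]
    rw [h1]
    refine Ideal.mul_mem_mul (Ideal.mem_span_singleton_self F) (sum_mem fun i _ => ?_)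
    refine Ideal.mul_mem_left _ _ (Ideal.mem_map_of_mem _ ?_)
    rw [← hu]
    exact Ideal.subset_span ⟨i, rfl⟩

end IsLocalRing

/-- By monotonicity and integrality, a value above `v` would keep `h` at least `v + 1`, while never
reaching `v` would keep it at most `v - 1`. Comparison with eventually constant sequences excludes
both. -/
theorem Filter.Tendsto.eventually_eq_of_average {h : ℕ → ℕ} {n₀ v : ℕ}
    (hmono : ∀ n ≥ n₀, h n ≤ h (n + 1))
    (hlim : Filter.Tendsto (fun n : ℕ => ((∑ i ∈ Finset.range n, h i : ℕ) : ℝ) / (n : ℝ))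
      Filter.atTop (nhds (v : ℝ))) : ∃ n₁, ∀ n ≥ n₁, h n = v := by
  have hmono' : ∀ m ≥ n₀, ∀ n ≥ m, h m ≤ h n := by
    intro m hm n hn
    induction n, hn using Nat.le_induction with
    | base => exact le_rfl
    | succ n hn ih => exact ih.trans (hmono n (hm.trans hn))
  have cesaro : ∀ (g : ℕ → ℝ) (c : ℝ) (n₁ : ℕ), (∀ n ≥ n₁, g n = c) →
      Filter.Tendsto (fun n : ℕ => (∑ i ∈ Finset.range n, g i) / (n : ℝ))
        Filter.atTop (nhds c) := by
    intro g c n₁ hg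
    have h1 : Filter.Tendsto g Filter.atTop (nhds c) :=
      tendsto_const_nhds.congr' (Filter.eventually_atTop.2 ⟨n₁, fun n hn => (hg n hn).symm⟩)
    simpa [div_eq_inv_mul] using h1.cesaro
  have hle : ∀ n ≥ n₀, h n ≤ v := by
    intro m hm
    by_contra! hcon
    have h1 := cesaro (fun n => if n < m then 0 else ((v + 1 : ℕ) : ℝ)) ((v + 1 : ℕ) : ℝ) m
      (fun n hn => if_neg (by omega))
    have h2 := le_of_tendsto_of_tendsto' h1 hlim (fun n => by
      push_cast
      gcongr with i
      split_ifs with hi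
      · positivity
      · exact_mod_cast (Nat.succ_le_of_lt hcon).trans (hmono' m hm i (by omega)))
    have h3 : v + 1 ≤ v := by exact_mod_cast h2
    omega
  obtain ⟨m, hm, hvm⟩ : ∃ m ≥ n₀, v ≤ h m := by
    by_contra! hcon
    have hv : 0 < v := lt_of_le_of_lt (Nat.zero_le _) (hcon n₀ le_rfl)
    have h1 := cesaro (fun n => if n < n₀ then (h n : ℝ) else ((v - 1 : ℕ) : ℝ)) ((v - 1 : ℕ) : ℝ)
      n₀ (fun n hn => if_neg (by omega))
    have h2 := le_of_tendsto_of_tendsto' hlim h1 (fun n => by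
      push_cast
      gcongr with i
      split_ifs with hi
      · exact le_rfl
      · have := hcon i (by omega)
        exact_mod_cast (show h i ≤ v - 1 by omega))
    have h3 : v ≤ v - 1 := by exact_mod_cast h2
    omega
  exact ⟨m, fun n hn => le_antisymm (hle n (hm.trans hn)) (hvm.trans (hmono' m hm n hn))⟩

/-! ### The local extension `R[X]/(g)`. -/

section Extension

variable {R : Type*} [CommRing R] [IsLocalRing R]

/-- A monic polynomial whose residue is irreducible and coprime to a given nonzero polynomial. -/
theorem IsLocalRing.exists_monic_irreducible_isCoprime {P : R[X]} (hP : P.map (residue R) ≠ 0) :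
    ∃ g : R[X], g.Monic ∧ Irreducible (g.map (residue R)) ∧
      IsCoprime (g.map (residue R)) (P.map (residue R)) := by
  set p := P.map (residue R)
  -- Any irreducible factor of `p * X + 1` is coprime to `p`, and one exists because the degree is
  -- positive; no size condition on the residue field is needed.
  have hdeg : (p * X + 1).natDegree = p.natDegree + 1 := by
    rw [← C_1, natDegree_add_C, natDegree_mul_X hP]
  have hne : p * X + 1 ≠ 0 := by
    intro h
    rw [h, natDegree_zero] at hdeg
    omega
  have hnu : ¬ IsUnit (p * X + 1) := by
    intro h
    rw [natDegree_eq_zero_of_isUnit h] at hdeg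
    omega
  obtain ⟨q, hq, hqd⟩ := WfDvdMonoid.exists_irreducible_factor hnu hne
  have hlead : q.leadingCoeff⁻¹ ≠ 0 := inv_ne_zero (leadingCoeff_ne_zero.2 hq.ne_zero)
  have hassoc : Associated (q * C q.leadingCoeff⁻¹) q :=
    associated_mul_unit_left _ _ (isUnit_C.2 (isUnit_iff_ne_zero.2 hlead))
  obtain ⟨g, hg, -, hgm⟩ := lifts_and_natDegree_eq_and_monic (f := residue R)
    ((mem_lifts _).2 (Polynomial.map_surjective _ residue_surjective _))
    (monic_mul_leadingCoeff_inv hq.ne_zero)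
  refine ⟨g, hgm, hg ▸ hassoc.irreducible_iff.2 hq, ?_⟩
  obtain ⟨r, hr⟩ := (hg ▸ hassoc.dvd.trans hqd : g.map (residue R) ∣ p * X + 1)
  exact ⟨r, -X, by linear_combination -hr⟩

variable {g : R[X]}

theorem AdjoinRoot.isMaximal_map_maximalIdeal (hirr : Irreducible (g.map (residue R))) :
    ((maximalIdeal R).map (AdjoinRoot.of g)).IsMaximal := by
  let _ := Ideal.Quotient.field (maximalIdeal R)
  have hirr' : Irreducible (g.map (Ideal.Quotient.mk (maximalIdeal R))) := hirr
  have h1 : (Ideal.span {g.map (Ideal.Quotient.mk (maximalIdeal R))}).IsMaximal :=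
    PrincipalIdealRing.isMaximal_of_irreducible hirr'
  rw [Ideal.Quotient.maximal_ideal_iff_isField_quotient] at h1 ⊢
  exact (AdjoinRoot.quotEquivQuotMap g (maximalIdeal R)).toMulEquiv.isField h1

theorem AdjoinRoot.eq_map_maximalIdeal_of_isMaximal (hg : g.Monic)
    (hirr : Irreducible (g.map (residue R))) {M : Ideal (AdjoinRoot g)} (hM : M.IsMaximal) :
    M = (maximalIdeal R).map (AdjoinRoot.of g) := by
  have hmax := AdjoinRoot.isMaximal_map_maximalIdeal hirr
  have := hg.finite_adjoinRoot
  have : Algebra.IsIntegral R (AdjoinRoot g) := inferInstance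
  have h1 : (M.comap (algebraMap R (AdjoinRoot g))).IsMaximal :=
    Ideal.isMaximal_comap_of_isIntegral_of_isMaximal M
  have h2 := IsLocalRing.eq_maximalIdeal h1
  refine (hmax.eq_of_le hM.ne_top ?_).symm
  rw [Ideal.map_le_iff_le_comap, ← h2, AdjoinRoot.algebraMap_eq]

theorem AdjoinRoot.isLocalRing_of_irreducible_map (hg : g.Monic)
    (hirr : Irreducible (g.map (residue R))) : IsLocalRing (AdjoinRoot g) :=
  IsLocalRing.of_unique_max_ideal ⟨_, AdjoinRoot.isMaximal_map_maximalIdeal hirr, fun _ hM =>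
    AdjoinRoot.eq_map_maximalIdeal_of_isMaximal hg hirr hM⟩

theorem AdjoinRoot.isUnit_mk_of_isCoprime [IsLocalRing (AdjoinRoot g)] {P : R[X]}
    (hmax : maximalIdeal (AdjoinRoot g) = (maximalIdeal R).map (AdjoinRoot.of g))
    (hcop : IsCoprime (g.map (residue R)) (P.map (residue R))) : IsUnit (AdjoinRoot.mk g P) := by
  obtain ⟨a, b, hab⟩ := hcop
  obtain ⟨a, rfl⟩ := Polynomial.map_surjective _ (residue_surjective (R := R)) a
  obtain ⟨b, rfl⟩ := Polynomial.map_surjective _ (residue_surjective (R := R)) b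
  have h1 : a * g + b * P - 1 ∈ (maximalIdeal R).map C := by
    rw [Ideal.mem_map_C_iff]
    intro n
    rw [← residue_eq_zero_iff, ← coeff_map]
    simp only [Polynomial.map_sub, Polynomial.map_add, Polynomial.map_mul, Polynomial.map_one]
    rw [hab, sub_self, coeff_zero]
  have h2 := Ideal.mem_map_of_mem (AdjoinRoot.mk g) h1
  rw [Ideal.map_map, show (AdjoinRoot.mk g).comp C = AdjoinRoot.of g from rfl, ← hmax] at h2
  simp only [map_sub, map_add, map_mul, AdjoinRoot.mk_self, mul_zero, zero_add, map_one] at h2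
  by_contra hcon
  have h3 : AdjoinRoot.mk g P ∈ maximalIdeal (AdjoinRoot g) := hcon
  have h4 := sub_mem (Ideal.mul_mem_left _ (AdjoinRoot.mk g b) h3) h2
  rw [sub_sub_cancel] at h4
  exact (Ideal.ne_top_iff_one _).1 (maximalIdeal.isMaximal _).ne_top h4

end Extension

/-! ### Lengths over finite free extensions. -/

section FreeExtension

variable {R S : Type*} [CommRing R] [CommRing S] [Algebra R S]

theorem Module.Basis.mem_map_algebraMap_iff {ι : Type*} [Fintype ι] (b : Module.Basis ι R S)
    (I : Ideal R) (s : S) : s ∈ I.map (algebraMap R S) ↔ ∀ i, b.repr s i ∈ I := by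
  constructor
  · intro hs
    have hs' : s ∈ I • (⊤ : Submodule R S) := by
      rw [Ideal.smul_top_eq_map]; exact hs
    induction hs' using Submodule.smul_induction_on' with
    | smul r hr x _ => intro i; simpa using Ideal.mul_mem_right _ _ hr
    | add x hx y hy hx' hy' =>
      rw [Ideal.smul_top_eq_map] at hx hy
      intro i
      simpa using add_mem (hx' hx i) (hy' hy i)
  · intro h
    rw [← b.sum_repr s]
    exact sum_mem fun i _ => by
      rw [Algebra.smul_def]
      exact Ideal.mul_mem_right _ _ (Ideal.mem_map_of_mem _ (h i))

theorem Module.Basis.length_quotient_map {ι : Type*} [Fintype ι] (b : Module.Basis ι R S)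
    (I : Ideal R) : Module.length R (S ⧸ I.map (algebraMap R S)) =
      Fintype.card ι * Module.length R (R ⧸ I) := by
  let φ : S →ₗ[R] (ι → R ⧸ I) := LinearMap.pi fun i => I.mkQ.comp (b.coord i)
  have hφ : Function.Surjective φ := by
    intro y
    choose r hr using fun i => Submodule.mkQ_surjective I (y i)
    refine ⟨∑ i, r i • b i, funext fun i => ?_⟩
    rw [← hr]
    simp only [φ, LinearMap.pi_apply, LinearMap.comp_apply, Module.Basis.coord_apply]
    rw [b.repr_sum_self]
  have hker : LinearMap.ker φ = (I.map (algebraMap R S)).restrictScalars R := by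
    ext s
    rw [Submodule.restrictScalars_mem, b.mem_map_algebraMap_iff, LinearMap.mem_ker, funext_iff]
    simp [φ, Ideal.Quotient.eq_zero_iff_mem]
  rw [((Submodule.Quotient.restrictScalarsEquiv R (I.map (algebraMap R S))).symm.trans
    ((Submodule.quotEquivOfEq _ _ hker.symm).trans (φ.quotKerEquivOfSurjective hφ))).length_eq,
    Module.length_pi_of_fintype]
  simp

variable (R) in
theorem Ideal.length_quotient_span_singleton_mul {f : S} (hf : IsLeftRegular f) (K : Ideal S) :
    Module.length R (S ⧸ span {f} * K) =
      Module.length R (S ⧸ K) + Module.length R (S ⧸ span {f}) := by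
  have hcomap : K = Submodule.comap (LinearMap.mulLeft S f) (span {f} * K) := by
    ext z
    rw [Submodule.mem_comap, LinearMap.mulLeft_apply, mem_span_singleton_mul]
    constructor
    · intro hz; exact ⟨z, hz, rfl⟩
    · rintro ⟨w, hw, h⟩
      exact hf h ▸ hw
  have hle : span {f} * K ≤ span {f} := Ideal.mul_le_left
  refine Module.length_eq_add_of_exact
    ((Submodule.mapQ K (span {f} * K) (LinearMap.mulLeft S f) hcomap.le).restrictScalars R)
    ((Submodule.factor hle).restrictScalars R) ?_ (Submodule.factor_surjective hle) ?_
  · have : Function.Injective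
        (Submodule.mapQ K (span {f} * K) (LinearMap.mulLeft S f) hcomap.le) := by
      rw [← LinearMap.ker_eq_bot, Submodule.ker_mapQ, ← hcomap, Submodule.mkQ_map_self]
    exact this
  · have : Function.Exact (Submodule.mapQ K (span {f} * K) (LinearMap.mulLeft S f) hcomap.le)
        (Submodule.factor hle) := by
      rw [LinearMap.exact_iff, Submodule.range_mapQ, Submodule.factor, Submodule.ker_mapQ,
        Submodule.comap_id]
      congr 1
      ext z
      simp [mem_span_singleton, Dvd.dvd, eq_comm]
    exact this

variable (R) in
theorem Ideal.eq_of_le_of_length_quotient_le {A B : Ideal S} (hAB : A ≤ B)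
    (hlen : Module.length R (S ⧸ A) ≤ Module.length R (S ⧸ B))
    (hfin : Module.length R (S ⧸ B) ≠ ⊤) : A = B := by
  let φ : S ⧸ A →ₗ[R] S ⧸ B := (Submodule.factor hAB).restrictScalars R
  have h1 := Module.length_eq_add_of_exact (LinearMap.ker φ).subtype φ
    (Submodule.subtype_injective _) (Submodule.factor_surjective hAB)
    (LinearMap.exact_subtype_ker_map φ)
  have h2 : Module.length R (LinearMap.ker φ) = 0 := by
    rw [h1] at hlen
    lift Module.length R (S ⧸ B) to ℕ using hfin with m
    by_contra hne
    have h3 : 1 ≤ Module.length R (LinearMap.ker φ) :=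
      Order.one_le_iff_pos.2 (pos_iff_ne_zero.2 hne)
    have h4 : (1 : ℕ∞) + m ≤ m := le_trans (by gcongr) hlen
    have h5 : 1 + m ≤ m := by exact_mod_cast h4
    omega
  rw [Module.length_eq_zero_iff, Submodule.subsingleton_iff_eq_bot, LinearMap.ker_eq_bot] at h2
  refine le_antisymm hAB fun z hz => ?_
  rw [← Submodule.Quotient.mk_eq_zero]
  apply h2
  rw [map_zero]
  exact (Submodule.Quotient.mk_eq_zero B).2 hz

/-- If `f` generates a reduction of the extended maximal ideal and the number of generators of
`𝔪 ^ N` is the embedding dimension, for a reduction exponent `N`, then `𝔪 ^ 2 = f 𝔪`. -/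
theorem IsLocalRing.map_maximalIdeal_sq_eq [IsLocalRing R] [IsNoetherianRing R] [Module.Free R S]
    [Module.Finite R S] {f : S} (hf : IsLeftRegular f)
    (hfm : f ∈ (maximalIdeal R).map (algebraMap R S)) {N : ℕ}
    (hN : (maximalIdeal R ^ (N + 1)).map (algebraMap R S) =
      Ideal.span {f} * (maximalIdeal R ^ N).map (algebraMap R S))
    (hv : (maximalIdeal R ^ N).spanFinrank = (maximalIdeal R).spanFinrank) :
    Ideal.span {f} * (maximalIdeal R).map (algebraMap R S) =
      (maximalIdeal R ^ 2).map (algebraMap R S) := by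
  let b := Module.Free.chooseBasis R S
  set d := Fintype.card (Module.Free.ChooseBasisIndex R S)
  have hlen : ∀ k, Module.length R (S ⧸ (maximalIdeal R ^ k).map (algebraMap R S)) =
      ((d * ∑ i ∈ Finset.range k, (maximalIdeal R ^ i).spanFinrank : ℕ) : ℕ∞) := by
    intro k
    rw [b.length_quotient_map, length_quotient_maximalIdeal_pow, Nat.cast_mul]
  refine Ideal.eq_of_le_of_length_quotient_le R ?_ ?_ ?_
  · rw [sq, Ideal.map_mul]
    exact Ideal.mul_mono_left ((Ideal.span_singleton_le_iff_mem _).2 hfm)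
  -- Exponent `N` yields `ℓ(S/f) = d μ(𝔪 ^ N) = d μ(𝔪)`. Hence `ℓ(S/f𝔪S) = d + d μ(𝔪) = ℓ(S/𝔪 ^ 2
  -- S)`.
  · have h1 := Ideal.length_quotient_span_singleton_mul R hf
      ((maximalIdeal R ^ N).map (algebraMap R S))
    have h2 := Ideal.length_quotient_span_singleton_mul R hf
      ((maximalIdeal R).map (algebraMap R S))
    have h3 := hlen 1
    rw [pow_one] at h3
    rw [← hN, hlen, hlen] at h1
    have hfin : Module.length R (S ⧸ Ideal.span {f}) ≠ ⊤ := by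
      intro h
      rw [h, add_top] at h1
      exact ENat.natCast_ne_top _ h1
    rw [h2, h3, hlen]
    lift Module.length R (S ⧸ Ideal.span {f}) to ℕ using hfin with m
    norm_cast at h1 ⊢
    rw [Finset.sum_range_succ, hv] at h1
    simp only [Finset.sum_range_succ, Finset.sum_range_zero, pow_one]
    linarith [mul_add d (∑ i ∈ Finset.range N, (maximalIdeal R ^ i).spanFinrank)
      (maximalIdeal R).spanFinrank, mul_add d (0 + (maximalIdeal R ^ 0).spanFinrank)
      (maximalIdeal R).spanFinrank]
  · rw [hlen]
    exact ENat.natCast_ne_top _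

end FreeExtension

theorem IsLeftRegular.algebraMap_of_free {R S : Type*} [CommRing R] [CommRing S] [Algebra R S]
    [Module.Free R S] {y : R} (hy : IsLeftRegular y) : IsLeftRegular (algebraMap R S y) := by
  let b := Module.Free.chooseBasis R S
  intro s t hst
  simp only [← Algebra.smul_def] at hst
  apply b.repr.injective
  ext i
  apply hy
  simpa using congrArg (fun s => b.repr s i) hst

/-! ### Existence of `f` with `𝔪 ^ 2 S = f 𝔪 S`. -/

section

variable {R : Type*} [CommRing R] [IsLocalRing R] [IsNoetherianRing R]

theorem IsLocalRing.exists_polynomial_span_coeff (I : Ideal R) :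
    ∃ F : R[X], Ideal.span (Set.range F.coeff) = I := by
  obtain ⟨u, hu, -⟩ := exists_minimal_generators I rfl
  refine ⟨∑ i : Fin I.spanFinrank, monomial (i : ℕ) (u i), le_antisymm ?_ ?_⟩
  · rw [Ideal.span_le]
    rintro _ ⟨l, rfl⟩
    rw [finsetSum_coeff]
    refine sum_mem fun i _ => ?_
    rw [coeff_monomial]
    split_ifs
    · rw [← hu]; exact Ideal.subset_span ⟨i, rfl⟩
    · exact zero_mem _
  · conv_lhs => rw [← hu]
    rw [Ideal.span_le]
    rintro _ ⟨i, rfl⟩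
    refine Ideal.subset_span ⟨i, ?_⟩
    rw [finsetSum_coeff, Finset.sum_eq_single i]
    · simp
    · intro j _ hj
      rw [coeff_monomial, if_neg]
      exact fun h => hj (Fin.ext h)
    · simp

/-- If the multiplicity equals the embedding dimension, a finite free local extension has an element
`f` of the extended maximal ideal with `𝔪 ^ 2 = f 𝔪`. -/
theorem IsLocalRing.exists_monic_sq_eq {y : R} (hy : y ∈ maximalIdeal R) (hreg : IsLeftRegular y)
    (hmult : (maximalIdeal R).HasMultiplicity (embeddingDim R)) :
    ∃ g : R[X], g.Monic ∧ Irreducible (g.map (residue R)) ∧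
      ∃ f ∈ (maximalIdeal R).map (AdjoinRoot.of g), IsLeftRegular f ∧
        Ideal.span {f} * (maximalIdeal R).map (AdjoinRoot.of g) =
          (maximalIdeal R ^ 2).map (AdjoinRoot.of g) := by
  obtain ⟨F, hF⟩ := exists_polynomial_span_coeff (maximalIdeal R)
  have hFm : ∀ i, F.coeff i ∈ maximalIdeal R := fun i =>
    hF.le (Ideal.subset_span ⟨i, rfl⟩)
  obtain ⟨n₀, h₀⟩ := exists_forall_coeff_mem_pow_succ F hF
  obtain ⟨n₁, h₁⟩ := Filter.Tendsto.eventually_eq_of_average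
    (h := fun n => (maximalIdeal R ^ n).spanFinrank) (n₀ := n₀) (v := embeddingDim R)
    (fun n hn => spanFinrank_pow_le_succ hFm (h₀ n hn)) (by
      refine hmult.congr fun n => ?_
      rw [length_quotient_maximalIdeal_pow, ENat.toNat_natCast])
  obtain ⟨N, hN₀, hN₁⟩ : ∃ N, n₀ ≤ N ∧ n₁ ≤ N := ⟨max n₀ n₁, le_max_left _ _, le_max_right _ _⟩
  obtain ⟨P, hP, hPF⟩ := exists_mul_mem_of_spanFinrank_eq hFm (h₀ N hN₀)
    ((h₁ N hN₁).trans (h₁ (N + 1) (by omega)).symm)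
  obtain ⟨g, hg, hirr, hcop⟩ := exists_monic_irreducible_isCoprime hP
  have := AdjoinRoot.isLocalRing_of_irreducible_map hg hirr
  have hmax := AdjoinRoot.eq_map_maximalIdeal_of_isMaximal hg hirr
    (maximalIdeal.isMaximal (AdjoinRoot g))
  have hunit := AdjoinRoot.isUnit_mk_of_isCoprime hmax hcop
  have := hg.finite_adjoinRoot
  have := hg.free_adjoinRoot
  have hcomp : (AdjoinRoot.mk g).comp C = AdjoinRoot.of g := rfl
  have hfm : AdjoinRoot.mk g F ∈ (maximalIdeal R).map (AdjoinRoot.of g) := by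
    rw [← hcomp, ← Ideal.map_map]
    exact Ideal.mem_map_of_mem _ (Ideal.mem_map_C_iff.2 hFm)
  have hred : (maximalIdeal R ^ (N + 1)).map (AdjoinRoot.of g) =
      Ideal.span {AdjoinRoot.mk g F} * (maximalIdeal R ^ N).map (AdjoinRoot.of g) := by
    apply le_antisymm
    · rw [Ideal.map_le_iff_le_comap]
      intro z hz
      have h2 := Ideal.mem_map_of_mem (AdjoinRoot.mk g) (hPF z hz)
      rw [Ideal.map_mul, Ideal.map_span, Set.image_singleton, Ideal.map_map, hcomp, map_mul] at h2
      exact (Ideal.unit_mul_mem_iff_mem _ hunit).1 h2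
    · rw [pow_succ', Ideal.map_mul]
      exact Ideal.mul_mono_left ((Ideal.span_singleton_le_iff_mem _).2 hfm)
  -- `f` divides the image of `y ^ (N + 1)`, which stays regular in a free extension.
  have hfreg : IsLeftRegular (AdjoinRoot.mk g F) := by
    have h3 : AdjoinRoot.of g (y ^ (N + 1)) ∈
        (maximalIdeal R ^ (N + 1)).map (AdjoinRoot.of g) :=
      Ideal.mem_map_of_mem _ (Ideal.pow_mem_pow hy _)
    rw [hred, Ideal.mem_span_singleton_mul] at h3
    obtain ⟨w, -, hw⟩ := h3
    have h4 : IsLeftRegular (AdjoinRoot.of g (y ^ (N + 1))) :=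
      (hreg.pow (N + 1)).algebraMap_of_free
    rw [← hw, mul_comm] at h4
    exact h4.of_mul
  exact ⟨g, hg, hirr, AdjoinRoot.mk g F, hfm, hfreg,
    map_maximalIdeal_sq_eq hfreg hfm hred (h₁ N hN₁)⟩

end

/-! ### Ulrich ideals and their extension to `S`. -/

section Ulrich

variable {R : Type*} [CommRing R] [IsLocalRing R]

theorem UlrichData.map_algebraMap {S : Type*} [CommRing S] [IsLocalRing S] [Algebra R S]
    [Module.Free R S] [Module.Finite R S] {I : Ideal R} {a : R} {ι : Type*} [Fintype ι] {u : ι → R}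
    (hmax : (maximalIdeal R).map (algebraMap R S) = maximalIdeal S) (h : UlrichData I a u) :
    UlrichData (I.map (algebraMap R S)) (algebraMap R S a) (fun i => algebraMap R S (u i)) where
  le_max := hmax ▸ Ideal.map_mono h.le_max
  regular := h.regular.algebraMap_of_free
  mem := Ideal.mem_map_of_mem _ h.mem
  sq_le z hz := by
    have h1 : I ^ 2 ≤ Ideal.span {a} * I := fun z hz => by
      obtain ⟨w, hw, rfl⟩ := h.sq_le z hz
      exact Ideal.mul_mem_mul (Ideal.mem_span_singleton_self a) hw
    rw [← Ideal.map_pow] at hz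
    have h2 := Ideal.map_mono (f := algebraMap R S) h1 hz
    rw [Ideal.map_mul, Ideal.map_span, Set.image_singleton, Ideal.mem_span_singleton_mul] at h2
    obtain ⟨w, hw, rfl⟩ := h2
    exact ⟨w, hw, rfl⟩
  span_eq := by
    conv_rhs => rw [← h.span_eq]
    rw [Ideal.map_span, ← Set.range_comp]
    rfl
  indep r hr i := by
    -- Since the `u i` come from `R`, a relation over `S` splits into one relation over `R` for each
    -- basis coordinate.
    let b := Module.Free.chooseBasis R S
    rw [← Ideal.map_pow, b.mem_map_algebraMap_iff] at hr
    rw [b.mem_map_algebraMap_iff]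
    intro j
    refine h.indep (fun i => b.repr (r i) j) ?_ i
    have := hr j
    simp_rw [mul_comm (r _), ← Algebra.smul_def, map_sum, map_smul] at this
    simpa [Finsupp.finsetSum_apply, mul_comm] using this
  nontrivial := h.nontrivial

theorem Ideal.IsUlrich.exists_ulrichData [IsNoetherianRing R] (hdim : ringKrullDim R = 1) {y : R}
    (hy : y ∈ maximalIdeal R) (hreg : IsLeftRegular y) {I : Ideal R} (hI : I.IsUlrich) :
    ∃ (a : R) (t : ℕ) (u : Fin t → R), UlrichData I a u := by
  obtain ⟨hprim, ⟨Q, ⟨hQprim, d, q, hd, hQ⟩, ⟨hQI, -⟩, hne, hsq⟩, hfree⟩ := hI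
  have hd1 : d = 1 := by
    rw [hdim] at hd
    exact_mod_cast hd.symm
  subst hd1
  set a := q 0
  have hQa : Q = Ideal.span {a} := by
    rw [hQ, Set.range_unique]
    rfl
  have hIm : I ≤ maximalIdeal R := hprim ▸ Ideal.le_radical
  have haI : a ∈ I := hQI (hQa ▸ Ideal.mem_span_singleton_self a)
  -- Some power of the regular element `y` is a multiple of `a`.
  have hareg : IsLeftRegular a := by
    have h1 : y ∈ Q.radical := hQprim.symm ▸ hy
    obtain ⟨k, hk⟩ := h1
    rw [hQa, Ideal.mem_span_singleton'] at hk
    obtain ⟨c, hc⟩ := hk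
    have h2 := hreg.pow k
    rw [← hc] at h2
    exact h2.of_mul
  have hsq' : ∀ z ∈ I ^ 2, ∃ w ∈ I, z = a * w := by
    intro z hz
    rw [hsq, hQa, Ideal.mem_span_singleton_mul] at hz
    obtain ⟨w, hw, rfl⟩ := hz
    exact ⟨w, hw, rfl⟩
  have : Nontrivial (R ⧸ I) :=
    Ideal.Quotient.nontrivial_iff.2 fun h =>
      (maximalIdeal.isMaximal R).ne_top (top_le_iff.1 (h ▸ hIm))
  have : Module.Finite R I.Cotangent := Module.Finite.of_surjective _ I.toCotangent_surjective
  have : Module.Finite (R ⧸ I) I.Cotangent := Module.Finite.of_restrictScalars_finite R _ _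
  let b := Module.finBasis (R ⧸ I) I.Cotangent
  choose v hv using fun i => I.toCotangent_surjective (b i)
  have hspan : Ideal.span (Set.range fun i => (v i : R)) = I := by
    refine le_antisymm (Ideal.span_le.2 (by rintro _ ⟨i, rfl⟩; exact (v i).2)) ?_
    -- Nakayama: lifts of a basis of `I / I ^ 2` generate `I`.
    refine Submodule.le_of_le_smul_of_le_jacobson_bot (I := I) I.fg_of_isNoetherianRing
      (by rwa [IsLocalRing.jacobson_eq_maximalIdeal _ bot_ne_top]) fun z hz => ?_
    choose r hr using fun i => Ideal.Quotient.mk_surjective (b.repr (I.toCotangent ⟨z, hz⟩) i)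
    have h1 : I.toCotangent (⟨z, hz⟩ - ∑ i, r i • v i) = 0 := by
      rw [map_sub, map_sum, sub_eq_zero, ← b.sum_repr (I.toCotangent ⟨z, hz⟩)]
      refine Finset.sum_congr rfl fun i _ => ?_
      rw [map_smul, hv, ← hr]
      rfl
    rw [Ideal.toCotangent_eq_zero] at h1
    have h2 : z = ∑ i, r i * (v i : R) + (z - ∑ i, r i * (v i : R)) := by ring
    rw [h2]
    refine Submodule.add_mem_sup (_root_.sum_mem fun i _ => Ideal.mul_mem_left _ _
      (Ideal.subset_span ⟨i, rfl⟩)) ?_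
    rw [smul_eq_mul, ← sq]
    simpa using h1
  refine ⟨a, _, fun i => (v i : R), hIm, hareg, haI, hsq', hspan, ?_, ?_⟩
  · intro r hr i
    have h1 : I.toCotangent (∑ i, r i • v i) = 0 := by
      rw [Ideal.toCotangent_eq_zero]
      simpa using hr
    rw [map_sum] at h1
    have h2 : ∑ i, Ideal.Quotient.mk I (r i) • b i = 0 := by
      rw [← h1]
      refine Finset.sum_congr rfl fun i _ => ?_
      rw [map_smul, hv]
      rfl
    exact Ideal.Quotient.eq_zero_iff_mem.1
      (Fintype.linearIndependent_iff.1 b.linearIndependent _ h2 i)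
  -- With at most one generator, `I = (c)` and `c ^ 2 = a t c`; cancelling `c` gives `c ∈ (a) = Q`,
  -- contradicting `I ≠ Q`.
  · by_contra hnt
    rw [not_nontrivial_iff_subsingleton] at hnt
    obtain ⟨c, hc⟩ : ∃ c, I = Ideal.span {c} := by
      rcases isEmpty_or_nonempty (Fin (Module.finrank (R ⧸ I) I.Cotangent)) with he | ⟨⟨i⟩⟩
      · exact ⟨0, by rw [← hspan]; simp⟩
      · refine ⟨v i, ?_⟩
        conv_lhs => rw [← hspan]
        congr 1
        ext z
        constructor
        · rintro ⟨j, rfl⟩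
          rw [Subsingleton.elim j i]; rfl
        · rintro rfl
          exact ⟨i, rfl⟩
    have hcI : c ∈ I := hc ▸ Ideal.mem_span_singleton_self c
    obtain ⟨s, hs⟩ := Ideal.mem_span_singleton'.1 (hc ▸ haI : a ∈ Ideal.span {c})
    have hcreg : IsLeftRegular c := by
      rw [← hs] at hareg
      exact hareg.of_mul
    obtain ⟨w, hw, hcw⟩ := hsq' _ (Ideal.mul_mem_sq hcI hcI)
    obtain ⟨t, ht⟩ := Ideal.mem_span_singleton'.1 (hc ▸ hw : w ∈ Ideal.span {c})
    apply hne
    refine le_antisymm ?_ hQI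
    rw [hc, hQa, Ideal.span_singleton_le_iff_mem, Ideal.mem_span_singleton]
    refine ⟨t, hcreg ?_⟩
    linear_combination hcw - a * ht

end Ulrich

theorem theorem5p3 {R : Type*} [CommRing R] [IsLocalRing R]
    (hCM : IsCohenMacaulayLocal R) (hdim : ringKrullDim R = 1)
    (e : ℝ) (he : (IsLocalRing.maximalIdeal R).HasMultiplicity e)
    (hve : (embeddingDim R : ℝ) = e) (he1 : 1 < e) :
    IsChain (· ≤ ·) (ulrichIdeals R) := by
  obtain ⟨hnoeth, rs, hrs, hlen⟩ := hCM
  obtain ⟨y, rfl⟩ : ∃ y, rs = [y] := by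
    rw [hdim] at hlen
    rw [← List.length_eq_one_iff]
    exact_mod_cast hlen.symm
  have hreg : IsLeftRegular y := by
    have := ((RingTheory.Sequence.isRegular_cons_iff _ _ _).1 hrs).1
    exact this
  have hy : y ∈ maximalIdeal R := by
    rw [mem_maximalIdeal, mem_nonunits_iff]
    intro hu
    apply hrs.top_ne_smul
    rw [Ideal.ofList_singleton, Ideal.span_singleton_eq_top.2 hu]
    simp
  subst hve
  obtain ⟨g, hg, hirr, f, hfm, hfreg, hsq⟩ := exists_monic_sq_eq hy hreg he
  have := AdjoinRoot.isLocalRing_of_irreducible_map hg hirr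
  have := hg.finite_adjoinRoot
  have := hg.free_adjoinRoot
  have hmax := AdjoinRoot.eq_map_maximalIdeal_of_isMaximal hg hirr
    (maximalIdeal.isMaximal (AdjoinRoot g))
  have : IsNoetherianRing (AdjoinRoot g) := inferInstance
  have hm : ∀ y ∈ maximalIdeal (AdjoinRoot g), ∀ z ∈ maximalIdeal (AdjoinRoot g),
      ∃ w ∈ maximalIdeal (AdjoinRoot g), y * z = f * w := by
    intro y hy z hz
    have h1 := Ideal.mul_mem_sq hy hz
    rw [hmax, ← Ideal.map_pow, ← hsq, Ideal.mem_span_singleton_mul, ← hmax] at h1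
    obtain ⟨w, hw, h⟩ := h1
    exact ⟨w, hw, h.symm⟩
  have hpow : ∀ I : Ideal R, I.IsUlrich → ∃ p, f ^ p ∈ I.map (algebraMap R (AdjoinRoot g)) := by
    intro I hI
    obtain ⟨p, hp⟩ := I.exists_radical_pow_le_of_fg (IsNoetherian.noetherian _)
    refine ⟨p, Ideal.map_mono hp ?_⟩
    rw [hI.1, Ideal.map_pow]
    exact Ideal.pow_mem_pow hfm p
  -- By faithful flatness, each ideal of `R` is the contraction of its extension.
  have hback : ∀ I J : Ideal R, I.map (algebraMap R (AdjoinRoot g)) ≤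
      J.map (algebraMap R (AdjoinRoot g)) → I ≤ J := by
    intro I J h
    have h1 := Ideal.comap_mono (f := algebraMap R (AdjoinRoot g)) h
    rw [Ideal.comap_map_eq_self_of_faithfullyFlat, Ideal.comap_map_eq_self_of_faithfullyFlat] at h1
    exact h1
  intro I hI J hJ _
  obtain ⟨a, t, u, hu⟩ := Ideal.IsUlrich.exists_ulrichData hdim hy hreg hI
  obtain ⟨b, s, v, hv⟩ := Ideal.IsUlrich.exists_ulrichData hdim hy hreg hJ
  exact ((hu.map_algebraMap hmax.symm).le_or_le (hv.map_algebraMap hmax.symm) hfreg hm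
    (hmax ▸ hfm) (hpow I hI) (hpow J hJ)).imp (hback I J) (hback J I)
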